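/- **Setting.** Let $\mathcal X,\mathcal Y$ be measurable spaces, let $\mu,\nu$ be probability distributions on $\mathcal X\times\mathcal Y$ (source and target) with $\mathcal X$-marginals $\mu_{\mathcal X},\nu_{\mathcal X}$, let $\ell:\mathcal Y\times\mathcal Y\to[0,1]$ be a measurable symmetric loss with $\ell(y_1,y_2)\le\ell(y_1,y_3)+\ell(y_3,y_2)$ for all $y_1,y_2,y_3$, and let $\mathcal H$ be a set of measurable functions $\mathcal X\to\mathcal Y$. For a distribution $\rho$ on $\mathcal X\times\mathcal Y$ put $R_\rho(h)=\mathbb E_{(X,Y)\sim\rho}\,\ell(h(X),Y)$; write $\ell(h,h')$ for the function $x\mapsto\ell(h(x),h'(x))$, with $\mathbb E_\mu$, $\mathrm{Var}_\mu$ of it taken under $\mu_{\mathcal X}$. For $s\in\mathbb R$ let $\mathcal H_s=\{h\in\mathcal H: R_\mu(h)\le s\}$ and $\mathcal H_s^\ell=\{\ell(h,h'):h,h'\in\mathcal H_s\}$. For distributions $P,Q$ on $\mathcal X$ define the localized $\chi^2$-domain discrepancy $$\mathrm D^{h,\mathcal H_r}_{\chi^2}(P\|Q)=\sup_{h'\in\mathcal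 H_r,\ t\ge 0}\Big\{\mathbb E_P[t\,\ell(h,h')]-\inf_{\alpha\in\mathbb R}\big(\mathbb E_Q[\phi^*(t\,\ell(h,h')+\alpha)]-\alpha\big)\Big\}\in[0,\infty],\qquad \phi^*(y)=\tfrac{y^2}{4}+y,$$ where $\phi^*$ is the convex conjugate of $\phi(x)=(x-1)^2$, $x\in\mathbb R$. Let $R^r_\mu(h)=\sup_{h'\in\mathcal H_r}\mathbb E_\mu\,\ell(h,h')$ and $\lambda_r^*=\inf_{h'\in\mathcal H_r}\big(R_\mu(h')+R_\nu(h')\big)$. For a sample $x=(x_1,\dots,x_n)$ and a class $\mathcal F$ of real functions let $\hat{\mathfrak R}_x(\mathcal F)=\mathbb E_\varepsilon\sup_{f\in\mathcal F}\frac1n\sum_{i}\varepsilon_i f(x_i)$ with independent uniform signs $\varepsilon_i$. Let $\mathcal S=((X_i,Y_i))_{i=1}^n$ be i.i.d. from $\mu$ and $\mathcal T=(X'_j)_{j=1}^m$ be i.i.d. from $\nu_{\mathcal X}$ ($n,m\ge1$), with empirical distributions $\hat\mu$ and $\hat\nu$; $R_{\hat\mu}(h)=\frac1n\sum_i\ell(h(X_i),Y_i)$,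 and $\hat{\mathfrak R}_{\mathcal S}$, $\hat{\mathfrak R}_{\mathcal T}$ are evaluated at the inputs $X_1,\dots,X_n$ and $X'_1,\dots,X'_m$. **Theorem.** For every $C_1>0$ there is a constant $K$, depending on $C_1$ only, such that the following holds in every such setting. Let $r,r_1\in\mathbb R$ with $\mathcal H_r\neq\emptyset$, let $h\in\mathcal H_{r_1}$, and let $C_2\in(0,1)$ satisfy $$\frac{C_1\,\mathrm{Var}_\mu(\ell(h,h'))}{4}\le C_2\,\mathbb E_\mu\,\ell(h,h')\qquad\text{for all }h'\in\mathcal H_r.$$ Then for every $\delta\in(0,1)$, with probability at least $1-\delta$, $$\begin{aligned}R_\nu(h)\le{}& R_{\hat\mu}(h)+\frac{\mathrm D^{h,\mathcal H_r}_{\chi^2}(\hat\nu\|\hat\mu)}{C_1}+C_2R^r_\mu(h)+\lambda_r^*+K\Big(\hat{\mathfrak R}_{\mathcal T}(\mathcal H^\ell_r)+\hat{\mathfrak R}_{\mathcal S}(\mathcal H^\ell_{\max\{r,r_1\}})\Big)\\&+K\Big(\frac{\log(1/\delta)}{n}+\frac{\log(1/\delta)}{m}\Big)+K\Big(\sqrt{\frac{(r_1+r)\log(1/\delta)}{n}}+\sqrt{\frac{(r_1+r)\log(1/\delta)}{m}}\Big).\end{aligned}$$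 -/

import Mathlib

open MeasureTheory ProbabilityTheory
open scoped ENNReal

universe u v w

noncomputable section

namespace DomainAdaptation

/-- Convex conjugate `φ^*(y) = sup_x (x y - φ x)` of a real function on the line. -/
def convexConj (φ : ℝ → ℝ) (y : ℝ) : ℝ := ⨆ x : ℝ, (x * y - φ x)

/-- The generator of the `χ²`-divergence. -/
def chiSq (x : ℝ) : ℝ := (x - 1) ^ 2

/-- The conjugate of the `χ²` generator is `y ^ 2 / 4 + y`. -/
theorem convexConj_chiSq (y : ℝ) : convexConj chiSq y = y ^ 2 / 4 + y := by
  unfold convexConj chiSq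
  have hle : ∀ x : ℝ, x * y - (x - 1) ^ 2 ≤ y ^ 2 / 4 + y := fun x => by
    nlinarith [sq_nonneg (x - 1 - y / 2)]
  refine le_antisymm (ciSup_le hle) ?_
  have h := le_ciSup (f := fun x : ℝ => x * y - (x - 1) ^ 2) ⟨_, by rintro _ ⟨x, rfl⟩; exact hle x⟩
    (1 + y / 2)
  refine le_trans (le_of_eq ?_) h
  ring

/-- Empirical distribution `(1/n) ∑ i, δ_{x i}` of a finite sample. -/
def empirical {α : Type*} [MeasurableSpace α] {n : ℕ} (x : Fin n → α) : Measure α :=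
  (n : ℝ≥0∞)⁻¹ • ∑ i, Measure.dirac (x i)

variable {𝒳 𝒴 : Type*} [MeasurableSpace 𝒳] [MeasurableSpace 𝒴]

/-- The risk `R_ρ(h) = E_{(X,Y) ~ ρ} ℓ(h(X), Y)`. -/
def risk (ℓ : 𝒴 → 𝒴 → ℝ) (ρ : Measure (𝒳 × 𝒴)) (h : 𝒳 → 𝒴) : ℝ :=
  ∫ z, ℓ (h z.1) z.2 ∂ρ

/-- The Rashomon set `H_r = {h ∈ H | R_μ(h) ≤ r}`. -/
def rashomon (ℓ : 𝒴 → 𝒴 → ℝ) (μ : Measure (𝒳 × 𝒴)) (H : Set (𝒳 → 𝒴)) (r : ℝ) :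
    Set (𝒳 → 𝒴) :=
  {h ∈ H | risk ℓ μ h ≤ r}

/-- The disagreement `ℓ(h, h')`, as a function of the input. -/
def disagree (ℓ : 𝒴 → 𝒴 → ℝ) (h h' : 𝒳 → 𝒴) (x : 𝒳) : ℝ := ℓ (h x) (h' x)

/-- The class `H^ℓ = {x ↦ ℓ(h(x), h'(x)) | h, h' ∈ H}`. -/
def lossClass (ℓ : 𝒴 → 𝒴 → ℝ) (H : Set (𝒳 → 𝒴)) : Set (𝒳 → ℝ) :=
  {f | ∃ h ∈ H, ∃ h' ∈ H, f = disagree ℓ h h'}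

/-- `I_{φ,Q}(g) = inf_α { E_Q[φ^*(g + α)] - α }`. -/
def shiftInf (φ : ℝ → ℝ) (Q : Measure 𝒳) (g : 𝒳 → ℝ) : ℝ :=
  ⨅ α : ℝ, (∫ x, convexConj φ (g x + α) ∂Q) - α

/-- The localized `f`-domain discrepancy
`D_φ^{h,H}(P‖Q) = sup_{h' ∈ H, t ≥ 0} E_P[t ℓ(h,h')] - I_{φ,Q}(t ℓ(h,h'))`;
the supremum may be infinite. -/
def localDD (φ : ℝ → ℝ) (ℓ : 𝒴 → 𝒴 → ℝ) (H : Set (𝒳 → 𝒴)) (h : 𝒳 → 𝒴) (P Q : Measure 𝒳) :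
    EReal :=
  ⨆ h' ∈ H, ⨆ t ∈ Set.Ici (0 : ℝ),
    (((∫ x, t * disagree ℓ h h' x ∂P) -
      shiftInf φ Q (fun x => t * disagree ℓ h h' x) : ℝ) : EReal)

/-- `sup_{h' ∈ H} E_Q[ℓ(h,h')]`. -/
def supDisagree (ℓ : 𝒴 → 𝒴 → ℝ) (H : Set (𝒳 → 𝒴)) (h : 𝒳 → 𝒴) (Q : Measure 𝒳) : ℝ :=
  ⨆ h' : H, ∫ x, disagree ℓ h h' x ∂Q

/-- The ideal joint risk `inf_{h ∈ H} (R_μ(h) + R_ν(h))`. -/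
def jointRisk (ℓ : 𝒴 → 𝒴 → ℝ) (H : Set (𝒳 → 𝒴)) (μ ν : Measure (𝒳 × 𝒴)) : ℝ :=
  ⨅ h : H, (risk ℓ μ h + risk ℓ ν h)

/-- Empirical Rademacher complexity `E_ε sup_{f ∈ F} (1/n) ∑ i, ε_i f(x_i)`, where `ε` is uniform
on the `2 ^ n` sign vectors. -/
def rademacher {α : Type*} {n : ℕ} (x : Fin n → α) (F : Set (α → ℝ)) : ℝ :=
  ((2 : ℝ) ^ n)⁻¹ * ∑ ε : Fin n → ℤˣ,
    ⨆ f : F, (1 / (n : ℝ)) * ∑ i, ((ε i : ℤ) : ℝ) * (f : α → ℝ) (x i)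

end DomainAdaptation

end

namespace DomainAdaptation

/-! Write f = ℓ(h,h'), B = 1 + C₁, L = log(1/δ), and let μf, μ̂f denote means. No uniform
convergence is needed: the discrepancy is a supremum, so one deterministic h' in H_r already bounds
it from below. Take h' minimizing the joint risk up to L/n. The Rademacher terms are then merely
nonnegative and can be dropped. Since R_ν(h) ≤ νf + R_ν(h'), it remains to bound νf.

If νf ≤ 4B(r₁+r), take t = C₁ and shift -C₁·μf, so that D/C₁ ≥ ν̂f - μ̂f - (C₁/4) μ̂(f-μf)². As μ̂f
≤ R_μ̂(h) + R_μ̂(h'), only the deviations of ν̂f and of μ̂G matter, where G is the loss of h' plus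
(C₁/4)(f-μf)². The mean of G is R_μ(h') + C₁Var/4, and the variance condition controls it. Both
means are O(r₁+r), so Bernstein's inequality gives the stated rates
(`measure_deviation_of_disagree_le`).

Otherwise νf > 4B·μf. Taking t = 4C₁ with zero shift and using f² ≤ f gives D/C₁ ≥ 4(ν̂f - Bμ̂f),
which alone exceeds νf up to O(L/n + L/m) (`measure_deviation_of_le_disagree`).

Each case uses one exponential Markov bound on a combined deviation, so it fails with probability at
most e^{-L} = δ. A union bound would lose a factor 2, which K·log(1/δ) cannot absorb as δ → 1. -/

/-- The mean of `f` over a finite sample. -/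
noncomputable def sampleMean {α : Type*} {n : ℕ} (x : Fin n → α) (f : α → ℝ) : ℝ :=
  (1 / (n : ℝ)) * ∑ i, f (x i)

theorem sampleMean_mem_Icc {α : Type*} {n : ℕ} (hn : 0 < n) (x : Fin n → α) {f : α → ℝ} {a b : ℝ}
    (hf : ∀ x, f x ∈ Set.Icc a b) : sampleMean x f ∈ Set.Icc a b := by
  have hn' : (0 : ℝ) < n := by exact_mod_cast hn
  have h1 : (n : ℝ) * a ≤ ∑ i, f (x i) := by
    simpa using Finset.card_nsmul_le_sum Finset.univ (fun i => f (x i)) a fun i _ => (hf (x i)).1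
  have h2 : ∑ i, f (x i) ≤ n * b := by
    simpa using Finset.sum_le_card_nsmul Finset.univ (fun i => f (x i)) b fun i _ => (hf (x i)).2
  unfold sampleMean
  rw [one_div_mul_eq_div]
  exact ⟨by rwa [le_div_iff₀' hn'], by rwa [div_le_iff₀' hn']⟩

/-! ### Bernstein-type exponential bounds. -/

section Concentration

variable {α β Ω : Type*} [MeasurableSpace α] [MeasurableSpace β] [MeasurableSpace Ω]

theorem integrable_of_mem_Icc {ρ : Measure α} [IsFiniteMeasure ρ] {f : α → ℝ}
    (hf : Measurable f) {a b : ℝ} (hab : ∀ x, f x ∈ Set.Icc a b) : Integrable f ρ :=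
  Integrable.of_mem_Icc a b hf.aemeasurable (Filter.Eventually.of_forall hab)

/-- Trades second moments for means, so that the Bernstein variance term is proportional to a risk.
-/
theorem integral_sq_le_mul {ρ : Measure α} [IsProbabilityMeasure ρ] {G : α → ℝ}
    (hG : Measurable G) {B : ℝ} (hB : ∀ x, G x ∈ Set.Icc 0 B) :
    ∫ x, G x ^ 2 ∂ρ ≤ B * ∫ x, G x ∂ρ := by
  rw [← integral_const_mul]
  refine integral_mono (integrable_of_mem_Icc (a := 0) (b := B ^ 2) (hG.pow_const 2) fun x => ?_)
    ((integrable_of_mem_Icc hG hB).const_mul B) fun x => ?_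
  · exact ⟨sq_nonneg _, pow_le_pow_left₀ (hB x).1 (hB x).2 2⟩
  · have := hB x
    simp only
    nlinarith [this.1, this.2]

theorem integrable_exp_mul {ρ : Measure α} [IsFiniteMeasure ρ] {G : α → ℝ}
    (hG : AEMeasurable G ρ) {a b : ℝ} (hB : ∀ x, G x ∈ Set.Icc a b) (θ : ℝ) :
    Integrable (fun x => Real.exp (θ * G x)) ρ :=
  integrable_exp_mul_of_mem_Icc hG (Filter.Eventually.of_forall hB)

/-- Bernstein-type bound on the moment generating function of a bounded nonnegative function. -/
theorem integral_exp_le {ρ : Measure α} [IsProbabilityMeasure ρ] {G : α → ℝ}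
    (hG : Measurable G) {B : ℝ} (hB : ∀ x, G x ∈ Set.Icc 0 B) {θ : ℝ} (hθ : |θ| * B ≤ 1) :
    ∫ x, Real.exp (θ * G x) ∂ρ ≤
      Real.exp (θ * (∫ x, G x ∂ρ) + θ ^ 2 * (B * ∫ x, G x ∂ρ)) := by
  have hi : Integrable G ρ := integrable_of_mem_Icc hG hB
  have hi2 : Integrable (fun x => G x ^ 2) ρ :=
    integrable_of_mem_Icc (a := 0) (b := B ^ 2) (hG.pow_const 2)
      fun x => ⟨sq_nonneg _, pow_le_pow_left₀ (hB x).1 (hB x).2 2⟩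
  -- e^u ≤ 1 + u + u² for |u| ≤ 1.
  have hpt : ∀ x, Real.exp (θ * G x) ≤ 1 + θ * G x + θ ^ 2 * G x ^ 2 := fun x => by
    have h1 : |θ * G x| ≤ 1 := by
      rw [abs_mul, abs_of_nonneg (hB x).1]
      exact (mul_le_mul_of_nonneg_left (hB x).2 (abs_nonneg θ)).trans hθ
    have := (abs_le.1 (Real.abs_exp_sub_one_sub_id_le h1)).2
    rw [mul_pow] at this
    linarith
  calc ∫ x, Real.exp (θ * G x) ∂ρ ≤ ∫ x, (1 + θ * G x + θ ^ 2 * G x ^ 2) ∂ρ :=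
        integral_mono (integrable_exp_mul hG.aemeasurable hB θ)
          (((integrable_const _).add (hi.const_mul θ)).add (hi2.const_mul _)) hpt
    _ = 1 + θ * (∫ x, G x ∂ρ) + θ ^ 2 * ∫ x, G x ^ 2 ∂ρ := by
        have hi1 : Integrable (fun x => 1 + θ * G x) ρ :=
          (integrable_const _).add (hi.const_mul θ)
        rw [integral_add hi1 (hi2.const_mul _), integral_add (integrable_const _) (hi.const_mul θ), integral_const_mul,
          integral_const_mul]
        simp
    _ ≤ 1 + θ * (∫ x, G x ∂ρ) + θ ^ 2 * (B * ∫ x, G x ∂ρ) := by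
        gcongr
        exact integral_sq_le_mul hG hB
    _ ≤ _ := by
        have := Real.add_one_le_exp (θ * (∫ x, G x ∂ρ) + θ ^ 2 * (B * ∫ x, G x ∂ρ))
        linarith

theorem aemeasurable_sampleMean {P : Measure Ω} {n : ℕ} {S : Fin n → Ω → α}
    (hS : ∀ i, AEMeasurable (S i) P) {G : α → ℝ} (hG : Measurable G) :
    AEMeasurable (fun ω => sampleMean (fun i => S i ω) G) P := by
  unfold sampleMean
  exact (Finset.aemeasurable_fun_sum _ fun i _ => hG.comp_aemeasurable (hS i)).const_mul _

/-- Bernstein-type bound on the moment generating function of a sample mean. -/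
theorem integral_exp_sampleMean_le {P : Measure Ω} [IsProbabilityMeasure P] {ρ : Measure α}
    [IsProbabilityMeasure ρ] {n : ℕ} (hn : 0 < n) {S : Fin n → Ω → α} (hS : iIndepFun S P)
    (hlaw : ∀ i, HasLaw (S i) ρ P) {G : α → ℝ}
    (hG : Measurable G) {B : ℝ} (hB : ∀ x, G x ∈ Set.Icc 0 B) {s : ℝ} (hs : |s| * B ≤ n) :
    ∫ ω, Real.exp (s * (sampleMean (fun i => S i ω) G - ∫ x, G x ∂ρ)) ∂P ≤
      Real.exp (s ^ 2 * (B * (∫ x, G x ∂ρ) / n)) := by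
  have hn' : (0 : ℝ) < n := by exact_mod_cast hn
  set a := ∫ x, G x ∂ρ with ha
  have hθ : |s / n| * B ≤ 1 := by
    rw [abs_div, Nat.abs_cast, div_mul_eq_mul_div, div_le_one hn']
    exact hs
  have hmgf : mgf (∑ i, G ∘ S i) P (s / n) ≤
      Real.exp ((s / n) * a + (s / n) ^ 2 * (B * a)) ^ n := by
    rw [(hS.comp (fun _ => G) fun _ => hG).mgf_sum₀
      (fun i => hG.comp_aemeasurable (hlaw i).aemeasurable)]
    calc ∏ i, mgf (G ∘ S i) P (s / n) ≤
        ∏ _i : Fin n, Real.exp ((s / n) * a + (s / n) ^ 2 * (B * a)) := by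
          refine Finset.prod_le_prod (fun i _ => mgf_nonneg) fun i _ => ?_
          have : mgf (G ∘ S i) P (s / n) = ∫ x, Real.exp ((s / n) * G x) ∂ρ :=
            (hlaw i).integral_comp (f := fun x => Real.exp ((s / n) * G x))
              (by fun_prop)
          rw [this]
          exact integral_exp_le hG hB hθ
      _ = _ := by simp
  have heq : ∀ ω, Real.exp (s * (sampleMean (fun i => S i ω) G - a)) =
      Real.exp (-(s * a)) * Real.exp ((s / n) * (∑ i, G ∘ S i) ω) := fun ω => by
    rw [← Real.exp_add]
    congr 1
    simp only [sampleMean, Finset.sum_apply, Function.comp_apply]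
    ring
  simp_rw [heq]
  rw [integral_const_mul]
  calc Real.exp (-(s * a)) * mgf (∑ i, G ∘ S i) P (s / n) ≤
      Real.exp (-(s * a)) * Real.exp ((s / n) * a + (s / n) ^ 2 * (B * a)) ^ n := by gcongr
    _ = _ := by
      rw [← Real.exp_nat_mul, ← Real.exp_add]
      congr 1
      field_simp
      ring

/-- One-sided joint deviation bound for two (possibly dependent) i.i.d. samples, without a
prefactor in front of the exponential. -/
theorem measure_sampleMean_deviation_le {P : Measure Ω} [IsProbabilityMeasure P]
    {μ : Measure α} {ν : Measure β} [IsProbabilityMeasure μ] [IsProbabilityMeasure ν]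
    {n m : ℕ} (hn : 0 < n) (hm : 0 < m)
    {S : Fin n → Ω → α} (hS : iIndepFun S P) (hSl : ∀ i, HasLaw (S i) μ P)
    {T : Fin m → Ω → β} (hT : iIndepFun T P) (hTl : ∀ i, HasLaw (T i) ν P)
    {G : α → ℝ} (hG : Measurable G) {B : ℝ} (hB : ∀ x, G x ∈ Set.Icc 0 B)
    {F : β → ℝ} (hF : Measurable F) (hF1 : ∀ x, F x ∈ Set.Icc 0 1)
    {lam : ℝ} (hlam : 0 < lam) (hlamn : 2 * lam * B ≤ n) (hlamm : 2 * lam ≤ m) (L : ℝ) :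
    P {ω | L / lam + 4 * lam * (B * (∫ x, G x ∂μ) / n + (∫ x, F x ∂ν) / m) ≤
        (sampleMean (fun i => S i ω) G - ∫ x, G x ∂μ) +
          ((∫ x, F x ∂ν) - sampleMean (fun j => T j ω) F)} ≤
      ENNReal.ofReal (Real.exp (-L)) := by
  set a := ∫ x, G x ∂μ with ha
  set b := ∫ x, F x ∂ν with hb
  have ha0 : 0 ≤ a := integral_nonneg fun x => (hB x).1
  have hb0 : 0 ≤ b := integral_nonneg fun x => (hF1 x).1
  have hB0 : 0 ≤ B := by
    obtain ⟨x⟩ := nonempty_of_isProbabilityMeasure μ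
    exact (hB x).1.trans (hB x).2
  set U : Ω → ℝ := fun ω => sampleMean (fun i => S i ω) G - a with hU
  set V : Ω → ℝ := fun ω => sampleMean (fun j => T j ω) F - b with hV
  have hUm : AEMeasurable U P :=
    (aemeasurable_sampleMean (fun i => (hSl i).aemeasurable) hG).sub_const a
  have hVm : AEMeasurable V P :=
    (aemeasurable_sampleMean (fun i => (hTl i).aemeasurable) hF).sub_const b
  have hUb : ∀ ω, U ω ∈ Set.Icc (0 - a) (B - a) := fun ω => by
    have := sampleMean_mem_Icc hn (fun i => S i ω) hB
    exact ⟨sub_le_sub_right this.1 a, sub_le_sub_right this.2 a⟩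
  have hVb : ∀ ω, V ω ∈ Set.Icc (0 - b) (1 - b) := fun ω => by
    have := sampleMean_mem_Icc hm (fun i => T i ω) hF1
    exact ⟨sub_le_sub_right this.1 b, sub_le_sub_right this.2 b⟩
  have hUe := integrable_exp_mul (ρ := P) hUm hUb (2 * lam)
  have hVe := integrable_exp_mul (ρ := P) hVm hVb (-(2 * lam))
  have hZe : Integrable (fun ω => Real.exp (lam * (U ω - V ω))) P :=
    integrable_exp_mul (hUm.sub hVm) (a := (0 - a) - (1 - b)) (b := (B - a) - (0 - b))
      (fun ω => ⟨sub_le_sub (hUb ω).1 (hVb ω).2, sub_le_sub (hUb ω).2 (hVb ω).1⟩) lam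
  set M := 4 * lam ^ 2 * (B * a / n + b / m) with hM
  have h1 : ∫ ω, Real.exp (2 * lam * U ω) ∂P ≤ Real.exp M := by
    refine (integral_exp_sampleMean_le hn hS hSl hG hB (s := 2 * lam) ?_).trans ?_
    · rwa [abs_of_pos (by positivity)]
    · rw [← ha, Real.exp_le_exp, hM]
      have : 0 ≤ b / m := by positivity
      nlinarith [mul_nonneg (sq_nonneg lam) this]
  have h2 : ∫ ω, Real.exp (-(2 * lam) * V ω) ∂P ≤ Real.exp M := by
    refine (integral_exp_sampleMean_le hm hT hTl hF hF1 (s := -(2 * lam)) ?_).trans ?_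
    · rw [abs_neg, abs_of_pos (by positivity), mul_one]
      exact hlamm
    · rw [← hb, Real.exp_le_exp, hM, one_mul]
      have : 0 ≤ B * a / n := by positivity
      nlinarith [mul_nonneg (sq_nonneg lam) this]
  have hmgf : mgf (fun ω => U ω - V ω) P lam ≤ Real.exp M := by
    -- AM–GM decouples the two samples, so they need not be independent of each other. The price is
    -- the doubled parameter 2λ, whence the constraints 2λB ≤ n and 2λ ≤ m.
    have hpt : ∀ ω, Real.exp (lam * (U ω - V ω)) ≤
        2⁻¹ * Real.exp (2 * lam * U ω) + 2⁻¹ * Real.exp (-(2 * lam) * V ω) := fun ω => by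
      have e1 : Real.exp (2 * lam * U ω) = Real.exp (lam * U ω) ^ 2 := by
        rw [← Real.exp_nat_mul]; congr 1; push_cast; ring
      have e2 : Real.exp (-(2 * lam) * V ω) = Real.exp (-(lam * V ω)) ^ 2 := by
        rw [← Real.exp_nat_mul]; congr 1; push_cast; ring
      have e3 : Real.exp (lam * (U ω - V ω)) =
          Real.exp (lam * U ω) * Real.exp (-(lam * V ω)) := by
        rw [← Real.exp_add]; congr 1; ring
      rw [e1, e2, e3]
      nlinarith [sq_nonneg (Real.exp (lam * U ω) - Real.exp (-(lam * V ω)))]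
    calc mgf (fun ω => U ω - V ω) P lam ≤
        ∫ ω, (2⁻¹ * Real.exp (2 * lam * U ω) + 2⁻¹ * Real.exp (-(2 * lam) * V ω)) ∂P :=
          integral_mono hZe ((hUe.const_mul _).add (hVe.const_mul _)) hpt
      _ = 2⁻¹ * ∫ ω, Real.exp (2 * lam * U ω) ∂P +
          2⁻¹ * ∫ ω, Real.exp (-(2 * lam) * V ω) ∂P := by
          rw [integral_add (hUe.const_mul _) (hVe.const_mul _), integral_const_mul,
            integral_const_mul]
      _ ≤ Real.exp M := by linarith
  have hch := measure_ge_le_exp_mul_mgf (μ := P) (X := fun ω => U ω - V ω)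
    (L / lam + 4 * lam * (B * a / n + b / m)) hlam.le hZe
  have hset : {ω | L / lam + 4 * lam * (B * a / n + b / m) ≤
      (sampleMean (fun i => S i ω) G - a) + (b - sampleMean (fun j => T j ω) F)} =
      {ω | L / lam + 4 * lam * (B * a / n + b / m) ≤ U ω - V ω} := by
    ext ω
    simp only [Set.mem_ofPred_eq, hU, hV]
    ring_nf
  rw [hset, ← ofReal_measureReal]
  refine ENNReal.ofReal_le_ofReal (hch.trans ?_)
  calc _ ≤ Real.exp (-lam * (L / lam + 4 * lam * (B * a / n + b / m))) * Real.exp M := by gcongr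
    _ = Real.exp (-L) := by
      rw [← Real.exp_add]
      congr 1
      rw [hM, mul_add, neg_mul, mul_div_cancel₀ _ hlam.ne']
      ring

end Concentration

/-! ### Lower bounds for the empirical discrepancy; sign of the Rademacher complexity. -/

section Discrepancy

variable {𝒳 𝒴 : Type*} [MeasurableSpace 𝒳] [MeasurableSpace 𝒴]

theorem integral_empirical {n : ℕ} (x : Fin n → 𝒳) {f : 𝒳 → ℝ} (hf : Measurable f) :
    ∫ z, f z ∂empirical x = sampleMean x f := by
  unfold empirical sampleMean
  rw [integral_smul_measure, integral_finsetSum_measure]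
  · simp_rw [integral_dirac' f _ hf.stronglyMeasurable]
    simp
  · exact fun i _ => integrable_dirac' hf.stronglyMeasurable (by simp)

theorem measurable_disagree {ℓ : 𝒴 → 𝒴 → ℝ} (hℓ : Measurable (Function.uncurry ℓ))
    {h h' : 𝒳 → 𝒴} (hh : Measurable h) (hh' : Measurable h') : Measurable (disagree ℓ h h') :=
  hℓ.comp (hh.prodMk hh')

theorem sampleMean_add {α : Type*} {n : ℕ} (x : Fin n → α) (f g : α → ℝ) :
    sampleMean x (fun z => f z + g z) = sampleMean x f + sampleMean x g := by
  simp only [sampleMean, Finset.sum_add_distrib, mul_add]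

theorem sampleMean_const_mul {α : Type*} {n : ℕ} (x : Fin n → α) (c : ℝ) (f : α → ℝ) :
    sampleMean x (fun z => c * f z) = c * sampleMean x f := by
  simp only [sampleMean, ← Finset.mul_sum]
  ring

theorem sampleMean_const {α : Type*} {n : ℕ} (hn : 0 < n) (x : Fin n → α) (c : ℝ) :
    sampleMean x (fun _ => c) = c := by
  have : (n : ℝ) ≠ 0 := by exact_mod_cast hn.ne'
  simp [sampleMean, this]

theorem sampleMean_mono {α : Type*} {n : ℕ} (x : Fin n → α) {f g : α → ℝ}
    (hfg : ∀ z, f z ≤ g z) : sampleMean x f ≤ sampleMean x g := by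
  unfold sampleMean
  gcongr
  exact hfg _

/-- Evaluating the shift at `α = -c` bounds `shiftInf` for the `χ²` generator. -/
theorem shiftInf_chiSq_empirical_le {n : ℕ} (hn : 0 < n) (x : Fin n → 𝒳) {g : 𝒳 → ℝ}
    (hg : Measurable g) (c : ℝ) :
    shiftInf chiSq (empirical x) g ≤
      sampleMean x g + 4⁻¹ * sampleMean x (fun z => (g z - c) ^ 2) := by
  -- The linear part of φ* cancels the shift and leaves a square. Hence the infimum over α is over a
  -- set bounded below, as `ciInf_le` requires.
  have key : ∀ α : ℝ, (∫ z, convexConj chiSq (g z + α) ∂empirical x) - α =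
      sampleMean x g + 4⁻¹ * sampleMean x (fun z => (g z + α) ^ 2) := fun α => by
    simp_rw [convexConj_chiSq]
    rw [integral_empirical x (by fun_prop)]
    have : (fun z => (g z + α) ^ 2 / 4 + (g z + α)) =
        fun z => (4⁻¹ * (g z + α) ^ 2 + g z) + α := by
      funext z; ring
    rw [this, sampleMean_add, sampleMean_add, sampleMean_const_mul, sampleMean_const hn]
    ring
  unfold shiftInf
  refine (ciInf_le ⟨sampleMean x g, ?_⟩ (-c)).trans ?_
  · rintro _ ⟨α, rfl⟩
    simp only [key]
    have : 0 ≤ sampleMean x (fun z => (g z + α) ^ 2) :=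
      mul_nonneg (by positivity) (Finset.sum_nonneg fun i _ => sq_nonneg _)
    linarith
  · rw [key]
    simp only [← sub_eq_add_neg, le_refl]

/-- Variational lower bound on the localized `χ²`-discrepancy of two empirical distributions. -/
theorem le_localDD_chiSq_div {ℓ : 𝒴 → 𝒴 → ℝ} (hℓ : Measurable (Function.uncurry ℓ))
    {H : Set (𝒳 → 𝒴)} {h h' : 𝒳 → 𝒴} (hh : Measurable h) (hh' : Measurable h') (hH : h' ∈ H)
    {n m : ℕ} (hn : 0 < n) (x : Fin n → 𝒳) (y : Fin m → 𝒳) {t : ℝ} (ht : 0 ≤ t) (c : ℝ)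
    {C : ℝ} (hC : 0 < C) :
    (((t * (sampleMean y (disagree ℓ h h') - sampleMean x (disagree ℓ h h')
        - t / 4 * sampleMean x (fun z => (disagree ℓ h h' z - c) ^ 2))) / C : ℝ) : EReal) ≤
      localDD chiSq ℓ H h (empirical y) (empirical x) / (C : EReal) := by
  have hf := measurable_disagree hℓ hh hh'
  rw [EReal.coe_div]
  refine EReal.div_le_div_right_of_nonneg (by exact_mod_cast hC.le) ?_
  unfold localDD
  refine le_trans ?_ (le_iSup₂_of_le h' hH (le_iSup₂_of_le t ht le_rfl))
  rw [EReal.coe_le_coe_iff, integral_empirical y (by fun_prop), sampleMean_const_mul]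
  have h1 := shiftInf_chiSq_empirical_le hn x (g := fun z => t * disagree ℓ h h' z)
    (by fun_prop) (t * c)
  have h2 : (fun z => (t * disagree ℓ h h' z - t * c) ^ 2) =
      fun z => t ^ 2 * (disagree ℓ h h' z - c) ^ 2 := by
    funext z; ring
  rw [h2, sampleMean_const_mul, sampleMean_const_mul] at h1
  linarith

/-- Each supremum dominates its value at one fixed f, and these values average to zero under ε ↦ -ε.
The bound b is essential: a real supremum of an unbounded family takes the default value 0. -/
theorem rademacher_nonneg {α : Type*} {n : ℕ} (hn : 0 < n) (x : Fin n → α) {F : Set (α → ℝ)}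
    (hF : F.Nonempty) {b : ℝ} (hb : ∀ f ∈ F, ∀ z, |f z| ≤ b) : 0 ≤ rademacher x F := by
  obtain ⟨f, hf⟩ := hF
  have hlb : ∀ ε : Fin n → ℤˣ, (1 / (n : ℝ)) * ∑ i, ((ε i : ℤ) : ℝ) * f (x i) ≤
      ⨆ f : F, (1 / (n : ℝ)) * ∑ i, ((ε i : ℤ) : ℝ) * (f : α → ℝ) (x i) := fun ε => by
    refine le_ciSup (f := fun f : F => (1 / (n : ℝ)) * ∑ i, ((ε i : ℤ) : ℝ) * (f : α → ℝ) (x i))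
      ⟨(1 / (n : ℝ)) * ∑ _i : Fin n, b, ?_⟩ ⟨f, hf⟩
    rintro _ ⟨g, rfl⟩
    dsimp only
    gcongr with i
    refine (le_abs_self _).trans ?_
    rw [abs_mul]
    have : |((ε i : ℤ) : ℝ)| = 1 := by
      rcases Int.units_eq_one_or (ε i) with h | h <;> simp [h]
    rw [this, one_mul]
    exact hb g g.2 _
  have hzero : ∑ ε : Fin n → ℤˣ, (1 / (n : ℝ)) * ∑ i, ((ε i : ℤ) : ℝ) * f (x i) = 0 := by
    have hneg : ∑ ε : Fin n → ℤˣ, (1 / (n : ℝ)) * ∑ i, ((ε i : ℤ) : ℝ) * f (x i) =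
        ∑ ε : Fin n → ℤˣ, (1 / (n : ℝ)) * ∑ i, (((-ε) i : ℤ) : ℝ) * f (x i) :=
      (Equiv.sum_comp (Equiv.neg (Fin n → ℤˣ))
        fun ε => (1 / (n : ℝ)) * ∑ i, ((ε i : ℤ) : ℝ) * f (x i)).symm
    have : ∑ ε : Fin n → ℤˣ, (1 / (n : ℝ)) * ∑ i, (((-ε) i : ℤ) : ℝ) * f (x i) =
        -∑ ε : Fin n → ℤˣ, (1 / (n : ℝ)) * ∑ i, ((ε i : ℤ) : ℝ) * f (x i) := by
      simp [Finset.sum_neg_distrib]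
    linarith
  unfold rademacher
  refine mul_nonneg (by positivity) ?_
  rw [← hzero]
  exact Finset.sum_le_sum fun ε _ => hlb ε

end Discrepancy

/-- The choice of the exponential parameter in Bernstein's inequality for two samples. -/
theorem exists_bernstein_parameter {B ρ L N M : ℝ} (hB : 1 ≤ B) (hρ : 0 ≤ ρ) (hL : 0 < L)
    (hN : 0 < N) (hM : 0 < M) :
    ∃ lam : ℝ, 0 < lam ∧ 2 * lam * B ≤ N ∧ 2 * lam ≤ M ∧
      ∀ a b : ℝ, a ≤ B * ρ → b ≤ 4 * B * ρ →
        L / lam + 4 * lam * (B * a / N + b / M) ≤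
          2 * B * (L / N + L / M) + (1 + 16 * B ^ 2) * (√(ρ * L / N) + √(ρ * L / M)) := by
  have hB0 : 0 < B := by linarith
  set s₁ := √(ρ / (N * L)) with hs₁
  set s₂ := √(ρ / (M * L)) with hs₂
  have hs₁0 : 0 ≤ s₁ := Real.sqrt_nonneg _
  have hs₂0 : 0 ≤ s₂ := Real.sqrt_nonneg _
  -- λ = 1/κ, where κ adds the reciprocals of the two caps on λ and of the balancing values √(NL/ρ),
  -- √(ML/ρ). Each summand is at most κ, which gives every constraint, while L/λ = Lκ splits
  -- exactly. The first two summands keep κ positive when ρ = 0.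
  set κ := 2 * B / N + 2 / M + s₁ + s₂ with hκ
  have hBN : 0 < 2 * B / N := by positivity
  have hMi : 0 < 2 / M := by positivity
  have hκ0 : 0 < κ := by positivity
  have hmul : ∀ X : ℝ, 0 < X → √(ρ * L / X) * √(ρ / (X * L)) = ρ / X := fun X hX => by
    rw [← Real.sqrt_mul (by positivity)]
    have : ρ * L / X * (ρ / (X * L)) = (ρ / X) ^ 2 := by field_simp
    rw [this, Real.sqrt_sq (by positivity)]
  have hLs : ∀ X : ℝ, 0 < X → L * √(ρ / (X * L)) = √(ρ * L / X) := fun X hX => by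
    have : ρ * L / X = L ^ 2 * (ρ / (X * L)) := by field_simp
    rw [this, Real.sqrt_mul (by positivity), Real.sqrt_sq hL.le]
  have hquad : ∀ X : ℝ, 0 < X → √(ρ / (X * L)) ≤ κ → κ⁻¹ * (ρ / X) ≤ √(ρ * L / X) :=
    fun X hX hle => by
      rw [← hmul X hX, inv_mul_le_iff₀ hκ0, mul_comm κ]
      gcongr
  refine ⟨κ⁻¹, inv_pos.2 hκ0, ?_, ?_, fun a b ha hb => ?_⟩
  · have : 2 * B / N ≤ κ := by linarith
    rw [div_le_iff₀ hN] at this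
    calc 2 * κ⁻¹ * B = κ⁻¹ * (2 * B) := by ring
      _ ≤ N := by rwa [inv_mul_le_iff₀ hκ0]
  · have : 2 / M ≤ κ := by linarith
    rw [div_le_iff₀ hM] at this
    rwa [mul_comm, inv_mul_le_iff₀ hκ0]
  · have h1 : L / κ⁻¹ = 2 * B * (L / N) + 2 * (L / M) + √(ρ * L / N) + √(ρ * L / M) := by
      rw [← hLs N hN, ← hLs M hM, div_inv_eq_mul, hκ]
      ring
    have h2 : κ⁻¹ * (ρ / N) ≤ √(ρ * L / N) := hquad N hN (by linarith)
    have h3 : κ⁻¹ * (ρ / M) ≤ √(ρ * L / M) := hquad M hM (by linarith)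
    have h4 : 4 * κ⁻¹ * (B * a / N + b / M) ≤
        4 * κ⁻¹ * (B * (B * ρ) / N + 4 * B * ρ / M) := by gcongr
    have h5 : 4 * κ⁻¹ * (B * (B * ρ) / N + 4 * B * ρ / M) =
        4 * B ^ 2 * (κ⁻¹ * (ρ / N)) + 16 * B * (κ⁻¹ * (ρ / M)) := by ring
    have h6 : 2 * (L / M) ≤ 2 * B * (L / M) := by
      have : 0 ≤ L / M := by positivity
      nlinarith
    have h7 : 4 * B ^ 2 * (κ⁻¹ * (ρ / N)) ≤ 16 * B ^ 2 * √(ρ * L / N) := by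
      gcongr
      norm_num
    have h8 : 16 * B * (κ⁻¹ * (ρ / M)) ≤ 16 * B ^ 2 * √(ρ * L / M) := by
      gcongr
      nlinarith
    linarith

/-! ### Triangle inequalities for risks. -/

section Risk

variable {𝒳 𝒴 : Type*} [MeasurableSpace 𝒳] [MeasurableSpace 𝒴]

theorem integral_fst {μ : Measure (𝒳 × 𝒴)} {f : 𝒳 → ℝ} (hf : Measurable f) :
    ∫ x, f x ∂μ.fst = ∫ z, f z.1 ∂μ :=
  integral_map measurable_fst.aemeasurable hf.aestronglyMeasurable

theorem measurable_loss {ℓ : 𝒴 → 𝒴 → ℝ} (hℓ : Measurable (Function.uncurry ℓ)) {h : 𝒳 → 𝒴}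
    (hh : Measurable h) : Measurable fun z : 𝒳 × 𝒴 => ℓ (h z.1) z.2 :=
  hℓ.comp ((hh.comp measurable_fst).prodMk measurable_snd)

variable {ℓ : 𝒴 → 𝒴 → ℝ} (hℓ : Measurable (Function.uncurry ℓ))
  (h01 : ∀ y y', ℓ y y' ∈ Set.Icc (0 : ℝ) 1)
  (htri : ∀ y₁ y₂ y₃, ℓ y₁ y₂ ≤ ℓ y₁ y₃ + ℓ y₃ y₂) {h h' : 𝒳 → 𝒴} (hh : Measurable h)
  (hh' : Measurable h')
include hℓ h01 htri hh hh'

theorem risk_le_integral_disagree_add_risk (ν : Measure (𝒳 × 𝒴)) [IsProbabilityMeasure ν] :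
    risk ℓ ν h ≤ ∫ x, disagree ℓ h h' x ∂ν.fst + risk ℓ ν h' := by
  have hf := measurable_disagree hℓ hh hh'
  rw [integral_fst hf]
  unfold risk
  have i1 : Integrable (fun z : 𝒳 × 𝒴 => disagree ℓ h h' z.1) ν :=
    integrable_of_mem_Icc (hf.comp measurable_fst) fun z => h01 _ _
  have i2 := integrable_of_mem_Icc (ρ := ν) (measurable_loss hℓ hh') fun z => h01 _ _
  rw [← integral_add i1 i2]
  exact integral_mono (integrable_of_mem_Icc (measurable_loss hℓ hh) fun z => h01 _ _)
    (i1.add i2) fun z => htri _ _ _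

theorem integral_disagree_le_risk_add_risk (hsymm : ∀ y y', ℓ y y' = ℓ y' y)
    (μ : Measure (𝒳 × 𝒴)) [IsProbabilityMeasure μ] :
    ∫ x, disagree ℓ h h' x ∂μ.fst ≤ risk ℓ μ h + risk ℓ μ h' := by
  have hf := measurable_disagree hℓ hh hh'
  rw [integral_fst hf]
  unfold risk
  have i1 := integrable_of_mem_Icc (ρ := μ) (measurable_loss hℓ hh) fun z => h01 _ _
  have i2 := integrable_of_mem_Icc (ρ := μ) (measurable_loss hℓ hh') fun z => h01 _ _
  rw [← integral_add i1 i2]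
  refine integral_mono (integrable_of_mem_Icc (a := 0) (b := 1) (hf.comp measurable_fst)
    fun z => h01 _ _) (i1.add i2) fun z => ?_
  simpa only [disagree, hsymm (h' z.1) z.2] using htri (h z.1) (h' z.1) z.2

end Risk

/-! ### Deviation bounds in the two regimes of the target disagreement. -/

section Target

variable {𝒳 𝒴 Ω : Type*} [MeasurableSpace 𝒳] [MeasurableSpace 𝒴] [MeasurableSpace Ω]
  {P : Measure Ω} [IsProbabilityMeasure P] {μ ν : Measure (𝒳 × 𝒴)} [IsProbabilityMeasure μ]
  [IsProbabilityMeasure ν] {ℓ : 𝒴 → 𝒴 → ℝ} (hℓ : Measurable (Function.uncurry ℓ))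
  (h01 : ∀ y y', ℓ y y' ∈ Set.Icc (0 : ℝ) 1) {h h' : 𝒳 → 𝒴} (hh : Measurable h)
  (hh' : Measurable h') {n m : ℕ} (hn : 0 < n) (hm : 0 < m)
  {S : Fin n → Ω → 𝒳 × 𝒴} (hS : iIndepFun S P) (hSl : ∀ i, HasLaw (S i) μ P)
  {T : Fin m → Ω → 𝒳} (hT : iIndepFun T P) (hTl : ∀ j, HasLaw (T j) ν.fst P)
include hℓ h01 hh hh' hn hm hS hSl hT hTl

/-- The target disagreement is controlled by its empirical version if it is at most of the order
of the source risks. -/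
theorem measure_deviation_of_disagree_le (hsymm : ∀ y y', ℓ y y' = ℓ y' y)
    (htri : ∀ y₁ y₂ y₃, ℓ y₁ y₂ ≤ ℓ y₁ y₃ + ℓ y₃ y₂) {C ρ L : ℝ} (hC : 0 < C) (hL : 0 < L)
    (hρ : risk ℓ μ h + risk ℓ μ h' ≤ ρ)
    (hq : ∫ x, disagree ℓ h h' x ∂ν.fst ≤ 4 * (1 + C) * ρ) :
    P {ω | ¬ (∫ x, disagree ℓ h h' x ∂ν.fst ≤
        sampleMean (fun i => S i ω) (fun z => ℓ (h z.1) z.2)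
        + (sampleMean (fun j => T j ω) (disagree ℓ h h')
            - sampleMean (fun i => (S i ω).1) (disagree ℓ h h')
            - C / 4 * sampleMean (fun i => (S i ω).1)
                (fun x => (disagree ℓ h h' x - ∫ x, disagree ℓ h h' x ∂μ.fst) ^ 2))
        + risk ℓ μ h' + C * variance (disagree ℓ h h') μ.fst / 4
        + (2 * (1 + C) * (L / n + L / m)
            + (1 + 16 * (1 + C) ^ 2) * (√(ρ * L / n) + √(ρ * L / m))))} ≤
      ENNReal.ofReal (Real.exp (-L)) := by
  have hf := measurable_disagree hℓ hh hh'
  have hf01 : ∀ x, disagree ℓ h h' x ∈ Set.Icc (0 : ℝ) 1 := fun x => h01 _ _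
  set f := disagree ℓ h h' with hfdef
  set p := ∫ x, f x ∂μ.fst with hp
  have hp0 : 0 ≤ p := integral_nonneg fun x => (hf01 x).1
  have hrh0 : 0 ≤ risk ℓ μ h := integral_nonneg fun z => (h01 _ _).1
  have hrh'0 : 0 ≤ risk ℓ μ h' := integral_nonneg fun z => (h01 _ _).1
  have hpρ : p ≤ ρ :=
    (integral_disagree_le_risk_add_risk hℓ h01 htri hh hh' hsymm μ).trans hρ
  have hp1 : p ≤ 1 := by
    have := integral_mono (integrable_of_mem_Icc hf hf01) (integrable_const (1 : ℝ))
      (μ := μ.fst) fun x => (hf01 x).2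
    simpa using this
  have hvar : variance f μ.fst = ∫ x, (f x - p) ^ 2 ∂μ.fst := variance_eq_integral hf.aemeasurable
  have hsq01 : ∀ x, (f x - p) ^ 2 ∈ Set.Icc (0 : ℝ) 1 := fun x =>
    ⟨sq_nonneg _, by
      have := hf01 x
      have h1 : |f x - p| ≤ 1 := abs_le.2 ⟨by linarith [this.1], by linarith [this.2]⟩
      rw [← sq_abs]
      exact pow_le_one₀ (abs_nonneg _) h1⟩
  have hvarp : variance f μ.fst ≤ p := by
    refine (variance_le_expectation_sq hf.aestronglyMeasurable).trans ?_
    have := integral_sq_le_mul (ρ := μ.fst) hf hf01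
    rwa [one_mul] at this
  set G : 𝒳 × 𝒴 → ℝ := fun z => ℓ (h' z.1) z.2 + C / 4 * (f z.1 - p) ^ 2 with hG
  have hloss := measurable_loss hℓ hh'
  have hsqm : Measurable fun z : 𝒳 × 𝒴 => (f z.1 - p) ^ 2 :=
    ((hf.comp measurable_fst).sub_const p).pow_const 2
  have hGm : Measurable G := hloss.add (hsqm.const_mul _)
  have hGb : ∀ z, G z ∈ Set.Icc 0 (1 + C) := fun z => by
    have h1 := h01 (h' z.1) z.2
    have h2 := hsq01 z.1
    constructor
    · have := mul_nonneg (by positivity : (0 : ℝ) ≤ C / 4) h2.1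
      simp only [hG]
      linarith [h1.1]
    · have := mul_le_mul_of_nonneg_left h2.2 (by positivity : (0 : ℝ) ≤ C / 4)
      simp only [hG]
      linarith [h1.2]
  have hGint : ∫ z, G z ∂μ = risk ℓ μ h' + C * variance f μ.fst / 4 := by
    rw [hvar, integral_fst (by fun_prop)]
    simp only [hG]
    rw [integral_add (integrable_of_mem_Icc hloss fun z => h01 _ _)
      ((integrable_of_mem_Icc hsqm fun z => hsq01 z.1).const_mul _), integral_const_mul]
    unfold risk
    ring
  obtain ⟨lam, hlam, hlamn, hlamm, hbound⟩ := exists_bernstein_parameter (B := 1 + C) (ρ := ρ)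
    (L := L) (N := n) (M := m) (by linarith) (hp0.trans hpρ) hL (by exact_mod_cast hn)
    (by exact_mod_cast hm)
  refine le_trans (measure_mono fun ω hω => ?_)
    (measure_sampleMean_deviation_le hn hm hS hSl hT hTl hGm hGb hf hf01 hlam hlamn hlamm L)
  rw [Set.mem_ofPred_eq, not_le] at hω
  rw [Set.mem_ofPred_eq]
  -- The mean of G is at most (1 + C)ρ, because R_μ(h') ≤ ρ and Var f ≤ p ≤ ρ.
  have hb := hbound (∫ z, G z ∂μ) (∫ x, f x ∂ν.fst) (by
    rw [hGint]
    nlinarith) hq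
  have hGs : sampleMean (fun i => S i ω) G = sampleMean (fun i => S i ω)
      (fun z => ℓ (h' z.1) z.2) + C / 4 * sampleMean (fun i => (S i ω).1)
        (fun x => (f x - p) ^ 2) := by
    simp only [hG]
    rw [sampleMean_add, sampleMean_const_mul]
    rfl
  -- The triangle inequality on the sample is where the empirical risk of h enters.
  have hfs : sampleMean (fun i => (S i ω).1) f ≤
      sampleMean (fun i => S i ω) (fun z => ℓ (h z.1) z.2) +
        sampleMean (fun i => S i ω) (fun z => ℓ (h' z.1) z.2) := by
    rw [← sampleMean_add]
    refine sampleMean_mono (fun i => S i ω) (f := fun z : 𝒳 × 𝒴 => f z.1) fun z => ?_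
    simpa only [hfdef, disagree, hsymm (h' z.1) z.2] using htri (h z.1) (h' z.1) z.2
  rw [hGs]
  rw [hGint] at hb ⊢
  linarith

/-- If the target disagreement dominates the source disagreement, it is controlled by the
difference of their empirical versions up to a term of order `1 / n + 1 / m`. -/
theorem measure_deviation_of_le_disagree {B L : ℝ} (hB : 1 ≤ B)
    (hq : 4 * B * ∫ x, disagree ℓ h h' x ∂μ.fst ≤ ∫ x, disagree ℓ h h' x ∂ν.fst) :
    P {ω | ¬ (∫ x, disagree ℓ h h' x ∂ν.fst ≤
        4 * (sampleMean (fun j => T j ω) (disagree ℓ h h')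
            - B * sampleMean (fun i => (S i ω).1) (disagree ℓ h h'))
        + 64 * (L * (B ^ 2 / n + 1 / m)))} ≤
      ENNReal.ofReal (Real.exp (-L)) := by
  have hf := measurable_disagree hℓ hh hh'
  have hf01 : ∀ x, disagree ℓ h h' x ∈ Set.Icc (0 : ℝ) 1 := fun x => h01 _ _
  set f := disagree ℓ h h' with hfdef
  set p := ∫ x, f x ∂μ.fst with hp
  set q := ∫ x, f x ∂ν.fst with hqdef
  have hp0 : 0 ≤ p := integral_nonneg fun x => (hf01 x).1
  have hq0 : 0 ≤ q := integral_nonneg fun x => (hf01 x).1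
  have hB0 : 0 < B := by linarith
  have hn' : (0 : ℝ) < n := by exact_mod_cast hn
  have hm' : (0 : ℝ) < m := by exact_mod_cast hm
  set G : 𝒳 × 𝒴 → ℝ := fun z => B * f z.1 with hG
  have hGm : Measurable G := (hf.comp measurable_fst).const_mul B
  have hGb : ∀ z, G z ∈ Set.Icc 0 B := fun z =>
    ⟨mul_nonneg hB0.le (hf01 z.1).1, mul_le_of_le_one_right hB0.le (hf01 z.1).2⟩
  have hGint : ∫ z, G z ∂μ = B * p := by
    rw [hp, integral_fst hf, ← integral_const_mul]
  -- With λ = 1/κ the quadratic term is at most (p + q)/4. Since p ≤ Bp ≤ q/4, at least 7q/16 > q/4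
  -- survives when q > 0; multiplying by 4 yields the constant 64 = 4·16.
  set κ := 16 * (B ^ 2 / n + 1 / m) with hκ
  have hx : 0 < B ^ 2 / n := by positivity
  have hy : 0 < 1 / (m : ℝ) := by positivity
  have hκ0 : 0 < κ := by positivity
  have hxκ : 16 * (κ⁻¹ * (B ^ 2 / n)) ≤ 1 := by
    rw [mul_left_comm, inv_mul_le_iff₀ hκ0]
    linarith
  have hyκ : 16 * (κ⁻¹ * (1 / m)) ≤ 1 := by
    rw [mul_left_comm, inv_mul_le_iff₀ hκ0]
    linarith
  have hlamm : 2 * κ⁻¹ ≤ m := by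
    rw [mul_one_div, ← mul_div_assoc, div_le_one hm'] at hyκ
    have := inv_pos.2 hκ0
    linarith
  have hlamn : 2 * κ⁻¹ * B ≤ n := by
    rw [← mul_div_assoc, ← mul_div_assoc, div_le_one hn'] at hxκ
    have := inv_pos.2 hκ0
    have : κ⁻¹ * B ≤ κ⁻¹ * B ^ 2 := by
      gcongr
      nlinarith
    have : 0 ≤ κ⁻¹ * B ^ 2 := by positivity
    linarith
  refine le_trans (measure_mono fun ω hω => ?_)
    (measure_sampleMean_deviation_le hn hm hS hSl hT hTl hGm hGb hf hf01 (inv_pos.2 hκ0) hlamn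
      hlamm L)
  rw [Set.mem_ofPred_eq, not_le] at hω
  rw [Set.mem_ofPred_eq]
  have hGs : sampleMean (fun i => S i ω) G = B * sampleMean (fun i => (S i ω).1) f := by
    simp only [hG]
    rw [sampleMean_const_mul]
    rfl
  have e1 : L / κ⁻¹ = 16 * (L * (B ^ 2 / n + 1 / m)) := by
    rw [div_inv_eq_mul, hκ]
    ring
  have e2 : 4 * κ⁻¹ * (B * (B * p) / n + q / m) =
      4 * ((κ⁻¹ * (B ^ 2 / n)) * p + (κ⁻¹ * (1 / m)) * q) := by ring
  rw [hGs, hGint, ← hqdef, e1, e2]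
  have h1 : 16 * (κ⁻¹ * (B ^ 2 / n)) * p ≤ 1 * p := by gcongr
  have h2 : 16 * (κ⁻¹ * (1 / m)) * q ≤ 1 * q := by gcongr
  have h3 : p ≤ B * p := by nlinarith
  linarith

end Target

end DomainAdaptation

/-! ### Choice of h' and the two cases. -/

theorem theorem7 (C₁ : ℝ) (hC₁ : 0 < C₁) :
    -- one constant, depending on `C₁` only, serves for all the `O(·)` terms
    ∃ K : ℝ, ∀ (𝒳 : Type u) (𝒴 : Type v) (Ω : Type w)
      [MeasurableSpace 𝒳] [MeasurableSpace 𝒴] [MeasurableSpace Ω]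
      (P : Measure Ω) [IsProbabilityMeasure P]
      (μ ν : Measure (𝒳 × 𝒴)) [IsProbabilityMeasure μ] [IsProbabilityMeasure ν]
      (ℓ : 𝒴 → 𝒴 → ℝ) (_ : Measurable (Function.uncurry ℓ))
      (_ : ∀ y y', ℓ y y' ∈ Set.Icc (0 : ℝ) 1)
      (_ : ∀ y y', ℓ y y' = ℓ y' y)
      (_ : ∀ y₁ y₂ y₃, ℓ y₁ y₂ ≤ ℓ y₁ y₃ + ℓ y₃ y₂)
      (H : Set (𝒳 → 𝒴)) (_ : ∀ h ∈ H, Measurable h)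
      (r r₁ : ℝ) (_ : (DomainAdaptation.rashomon ℓ μ H r).Nonempty)
      (h : 𝒳 → 𝒴) (_ : h ∈ DomainAdaptation.rashomon ℓ μ H r₁)
      (C₂ : ℝ) (_ : C₂ ∈ Set.Ioo (0 : ℝ) 1)
      (_ : ∀ h' ∈ DomainAdaptation.rashomon ℓ μ H r,
        C₁ * variance (DomainAdaptation.disagree ℓ h h') μ.fst / 4 ≤
          C₂ * ∫ x, DomainAdaptation.disagree ℓ h h' x ∂μ.fst)
      (n m : ℕ) (_ : 0 < n) (_ : 0 < m)
      -- the labelled source sample and the unlabelled target sample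
      (S : Fin n → Ω → 𝒳 × 𝒴) (_ : iIndepFun S P) (_ : ∀ i, HasLaw (S i) μ P)
      (T : Fin m → Ω → 𝒳) (_ : iIndepFun T P) (_ : ∀ j, HasLaw (T j) ν.fst P)
      (δ : ℝ) (_ : δ ∈ Set.Ioo (0 : ℝ) 1),
      P {ω | ¬ ((DomainAdaptation.risk ℓ ν h : EReal) ≤
          (DomainAdaptation.risk ℓ (DomainAdaptation.empirical (fun i => S i ω)) h : EReal)
          + DomainAdaptation.localDD DomainAdaptation.chiSq ℓ
              (DomainAdaptation.rashomon ℓ μ H r) h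
              (DomainAdaptation.empirical (fun j => T j ω))
              (DomainAdaptation.empirical (fun i => (S i ω).1)) / (C₁ : EReal)
          + ((C₂ * DomainAdaptation.supDisagree ℓ (DomainAdaptation.rashomon ℓ μ H r) h μ.fst
              + DomainAdaptation.jointRisk ℓ (DomainAdaptation.rashomon ℓ μ H r) μ ν
              + K * (DomainAdaptation.rademacher (fun j => T j ω)
                    (DomainAdaptation.lossClass ℓ (DomainAdaptation.rashomon ℓ μ H r))
                  + DomainAdaptation.rademacher (fun i => (S i ω).1)
                    (DomainAdaptation.lossClass ℓ
                      (DomainAdaptation.rashomon ℓ μ H (max r r₁))))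
              + K * (Real.log (1 / δ) / n + Real.log (1 / δ) / m)
              + K * (√((r₁ + r) * Real.log (1 / δ) / n)
                  + √((r₁ + r) * Real.log (1 / δ) / m)) : ℝ) : EReal))}
        ≤ ENNReal.ofReal δ := by
  -- The large-disagreement case needs 64B² plus 1 for the slack L/n in the choice of h'; the other
  -- case needs only 2B + 1 and 1 + 16B².
  refine ⟨65 * (1 + C₁) ^ 2, ?_⟩
  intro 𝒳 𝒴 Ω _ _ _ P _ μ ν _ _ ℓ hℓ h01 hsymm htri H hHm r r₁ hne h hh C₂ hC₂ hvar n m hn hm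
    S hS hSl T hT hTl δ hδ
  set K := 65 * (1 + C₁) ^ 2 with hK
  set L := Real.log (1 / δ) with hLdef
  have hL : 0 < L := Real.log_pos (one_lt_one_div hδ.1 hδ.2)
  have hδL : δ = Real.exp (-L) := by
    rw [hLdef, one_div, Real.log_inv, neg_neg, Real.exp_log hδ.1]
  have hn' : (0 : ℝ) < n := by exact_mod_cast hn
  have hm' : (0 : ℝ) < m := by exact_mod_cast hm
  have hLn : 0 < L / n := by positivity
  have hLm : 0 < L / m := by positivity
  have hB2 : 1 + C₁ ≤ (1 + C₁) ^ 2 := by nlinarith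
  have hhm : Measurable h := hHm h hh.1
  have : Nonempty (DomainAdaptation.rashomon ℓ μ H r) := hne.to_subtype
  -- The infimum need not be attained, hence the slack L/n. This h' does not depend on the samples.
  obtain ⟨⟨h', hh'⟩, hjoint⟩ := exists_lt_of_ciInf_lt
    (show DomainAdaptation.jointRisk ℓ (DomainAdaptation.rashomon ℓ μ H r) μ ν <
      DomainAdaptation.jointRisk ℓ (DomainAdaptation.rashomon ℓ μ H r) μ ν + L / n by linarith)
  simp only at hjoint
  have hhm' : Measurable h' := hHm h' hh'.1
  have hrν := DomainAdaptation.risk_le_integral_disagree_add_risk hℓ h01 htri hhm hhm' ν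
  have hp := DomainAdaptation.integral_disagree_le_risk_add_risk hℓ h01 htri hhm hhm' hsymm μ
  have hp0 : 0 ≤ ∫ x, DomainAdaptation.disagree ℓ h h' x ∂μ.fst :=
    integral_nonneg fun x => (h01 _ _).1
  have hρ : DomainAdaptation.risk ℓ μ h + DomainAdaptation.risk ℓ μ h' ≤ r₁ + r :=
    add_le_add hh.2 hh'.2
  have hr'0 : 0 ≤ DomainAdaptation.risk ℓ μ h' := integral_nonneg fun z => (h01 _ _).1
  have hsup : ∫ x, DomainAdaptation.disagree ℓ h h' x ∂μ.fst ≤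
      DomainAdaptation.supDisagree ℓ (DomainAdaptation.rashomon ℓ μ H r) h μ.fst := by
    refine le_ciSup (f := fun g : DomainAdaptation.rashomon ℓ μ H r =>
      ∫ x, DomainAdaptation.disagree ℓ h g x ∂μ.fst) ⟨1, ?_⟩ ⟨h', hh'⟩
    rintro _ ⟨⟨g, hg⟩, rfl⟩
    have hgm := DomainAdaptation.measurable_disagree hℓ hhm (hHm g hg.1)
    simpa using integral_mono (μ := μ.fst)
      (DomainAdaptation.integrable_of_mem_Icc hgm fun x => h01 _ _)
      (integrable_const (1 : ℝ)) fun x => (h01 (h x) (g x)).2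
  have hCp : C₂ * ∫ x, DomainAdaptation.disagree ℓ h h' x ∂μ.fst ≤
      C₂ * DomainAdaptation.supDisagree ℓ (DomainAdaptation.rashomon ℓ μ H r) h μ.fst :=
    mul_le_mul_of_nonneg_left hsup hC₂.1.le
  have hCsup0 := (mul_nonneg hC₂.1.le hp0).trans hCp
  have hrad : ∀ s, h' ∈ DomainAdaptation.rashomon ℓ μ H s → ∀ (k : ℕ) (_ : 0 < k) (x : Fin k → 𝒳),
      0 ≤ DomainAdaptation.rademacher x
        (DomainAdaptation.lossClass ℓ (DomainAdaptation.rashomon ℓ μ H s)) := by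
    intro s hs k hk x
    refine DomainAdaptation.rademacher_nonneg hk x ⟨_, h', hs, h', hs, rfl⟩ (b := 1) ?_
    rintro _ ⟨g, -, g', -, rfl⟩ z
    exact (abs_of_nonneg (h01 (g z) (g' z)).1).trans_le (h01 (g z) (g' z)).2
  have hsamp : ∀ ω, DomainAdaptation.risk ℓ (DomainAdaptation.empirical fun i => S i ω) h =
      DomainAdaptation.sampleMean (fun i => S i ω) (fun z => ℓ (h z.1) z.2) := fun ω =>
    DomainAdaptation.integral_empirical _ (DomainAdaptation.measurable_loss hℓ hhm)
  -- it suffices to bound the discrepancy from below by a real number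
  have hreduce : ∀ (ω : Ω) (d : ℝ), (d : EReal) ≤
      DomainAdaptation.localDD DomainAdaptation.chiSq ℓ (DomainAdaptation.rashomon ℓ μ H r) h
        (DomainAdaptation.empirical (fun j => T j ω))
        (DomainAdaptation.empirical (fun i => (S i ω).1)) / (C₁ : EReal) →
      DomainAdaptation.risk ℓ ν h ≤
        DomainAdaptation.sampleMean (fun i => S i ω) (fun z => ℓ (h z.1) z.2) + d
        + (C₂ * DomainAdaptation.supDisagree ℓ (DomainAdaptation.rashomon ℓ μ H r) h μ.fst
          + DomainAdaptation.jointRisk ℓ (DomainAdaptation.rashomon ℓ μ H r) μ ν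
          + K * (L / n + L / m) + K * (√((r₁ + r) * L / n) + √((r₁ + r) * L / m))) →
      (DomainAdaptation.risk ℓ ν h : EReal) ≤
          (DomainAdaptation.risk ℓ (DomainAdaptation.empirical (fun i => S i ω)) h : EReal)
          + DomainAdaptation.localDD DomainAdaptation.chiSq ℓ
              (DomainAdaptation.rashomon ℓ μ H r) h
              (DomainAdaptation.empirical (fun j => T j ω))
              (DomainAdaptation.empirical (fun i => (S i ω).1)) / (C₁ : EReal)
          + ((C₂ * DomainAdaptation.supDisagree ℓ (DomainAdaptation.rashomon ℓ μ H r) h μ.fst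
              + DomainAdaptation.jointRisk ℓ (DomainAdaptation.rashomon ℓ μ H r) μ ν
              + K * (DomainAdaptation.rademacher (fun j => T j ω)
                    (DomainAdaptation.lossClass ℓ (DomainAdaptation.rashomon ℓ μ H r))
                  + DomainAdaptation.rademacher (fun i => (S i ω).1)
                    (DomainAdaptation.lossClass ℓ
                      (DomainAdaptation.rashomon ℓ μ H (max r r₁))))
              + K * (L / n + L / m)
              + K * (√((r₁ + r) * L / n) + √((r₁ + r) * L / m)) : ℝ) : EReal) := by
    intro ω d hd hle
    have hR : 0 ≤ K * (DomainAdaptation.rademacher (fun j => T j ω)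
          (DomainAdaptation.lossClass ℓ (DomainAdaptation.rashomon ℓ μ H r))
        + DomainAdaptation.rademacher (fun i => (S i ω).1)
          (DomainAdaptation.lossClass ℓ (DomainAdaptation.rashomon ℓ μ H (max r r₁)))) :=
      mul_nonneg (by positivity) (add_nonneg (hrad r hh' m hm _)
        (hrad _ ⟨hh'.1, hh'.2.trans (le_max_left _ _)⟩ n hn _))
    rw [hsamp]
    refine le_trans ?_ (add_le_add_left (add_le_add_right hd _) _)
    rw [← EReal.coe_add, ← EReal.coe_add, EReal.coe_le_coe_iff]
    linarith
  rw [hδL]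
  have hsqrt0 : 0 ≤ √((r₁ + r) * L / n) + √((r₁ + r) * L / m) := by positivity
  rcases le_or_gt (∫ x, DomainAdaptation.disagree ℓ h h' x ∂ν.fst) (4 * (1 + C₁) * (r₁ + r))
    with hq | hq
  · refine le_trans (measure_mono fun ω => ?_)
      (DomainAdaptation.measure_deviation_of_disagree_le hℓ h01 hhm hhm' hn hm hS hSl hT hTl hsymm
        htri hC₁ hL hρ hq)
    refine mt fun hω => ?_
    refine hreduce ω _ (DomainAdaptation.le_localDD_chiSq_div hℓ hhm hhm' hh' hn
      (fun i => (S i ω).1) (fun j => T j ω) hC₁.le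
      (∫ x, DomainAdaptation.disagree ℓ h h' x ∂μ.fst) hC₁) ?_
    rw [mul_div_cancel_left₀ _ hC₁.ne']
    have hv := hvar h' hh'
    have k1 : 2 * (1 + C₁) * (L / n + L / m) + L / n ≤ K * (L / n + L / m) := by
      have : 2 * (1 + C₁) + 1 ≤ K := by linarith
      have := mul_le_mul_of_nonneg_right this (by positivity : 0 ≤ L / n + L / m)
      linarith
    have k2 : (1 + 16 * (1 + C₁) ^ 2) * (√((r₁ + r) * L / n) + √((r₁ + r) * L / m)) ≤
        K * (√((r₁ + r) * L / n) + √((r₁ + r) * L / m)) :=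
      mul_le_mul_of_nonneg_right (by linarith) hsqrt0
    linarith
  · have hB : (1 : ℝ) ≤ 1 + C₁ := by linarith
    refine le_trans (measure_mono fun ω => ?_)
      (DomainAdaptation.measure_deviation_of_le_disagree hℓ h01 hhm hhm' hn hm hS hSl hT hTl hB
        (L := L) ((mul_le_mul_of_nonneg_left (hp.trans hρ) (by positivity)).trans hq.le))
    refine mt fun hω => ?_
    -- t = 4C₁ makes the penalty C₁·μ̂(f²) ≤ C₁·μ̂f, which produces the factor B = 1 + C₁.
    refine hreduce ω _ (DomainAdaptation.le_localDD_chiSq_div hℓ hhm hhm' hh' hn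
      (fun i => (S i ω).1) (fun j => T j ω) (mul_nonneg zero_le_four hC₁.le) 0 hC₁) ?_
    have e : ∀ X : ℝ, 4 * C₁ * X / C₁ = 4 * X := fun X => by field_simp
    rw [e]
    have hsq : DomainAdaptation.sampleMean (fun i => (S i ω).1)
        (fun z => (DomainAdaptation.disagree ℓ h h' z - 0) ^ 2) ≤
        DomainAdaptation.sampleMean (fun i => (S i ω).1) (DomainAdaptation.disagree ℓ h h') :=
      DomainAdaptation.sampleMean_mono _ fun z => by
        have := h01 (h z) (h' z)
        rw [sub_zero, sq]
        exact mul_le_of_le_one_left this.1 this.2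
    have hsq' := mul_le_mul_of_nonneg_left hsq hC₁.le
    have hs0 := (DomainAdaptation.sampleMean_mem_Icc hn (fun i => S i ω)
      (f := fun z => ℓ (h z.1) z.2) fun z => h01 _ _).1
    have k0 : 0 ≤ K * (√((r₁ + r) * L / n) + √((r₁ + r) * L / m)) :=
      mul_nonneg (by positivity) hsqrt0
    have k1 : 64 * (L * ((1 + C₁) ^ 2 / n + 1 / m)) + L / n ≤ K * (L / n + L / m) := by
      have e1 : 64 * (L * ((1 + C₁) ^ 2 / n + 1 / m)) =
          64 * (1 + C₁) ^ 2 * (L / n) + 64 * (L / m) := by ring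
      rw [e1, hK]
      nlinarith
    have e2 : 4 * C₁ / 4 = C₁ := by ring
    rw [e2]
    linarith
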